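/- **Conventions.** A simplicial complex is a family of finite sets closed under taking subsets; $\langle G_1,\dots,G_q\rangle$ is the complex generated by $G_1,\dots,G_q$, and $\langle\ \rangle$ is the void complex, without any face. A facet is a maximal face, and a subcollection of $\Delta$ is a complex whose facets are facets of $\Delta$. Write $F_W^c=W\setminus F$. Let $K$ be a field and let $\widetilde H_i(\cdot)$, $i\in\mathbb Z$, be reduced simplicial homology with coefficients in $K$ (the empty face, if present, is in degree $-1$). Let $l,m,n$ be positive integers with $2\le m\le n$, $l\mid n$ and $l\le\min\{m-1,\frac n2\}$. Write $m=tl+s$ with $0\le s<l$ and suppose $t\ge 2$. Let $\Delta_{m,l}(C_n)$ be the path complex of the $n$-cycle on $\{x_1,\dots,x_n\}$, generated by the sets $\{x_{(a-1)l+1},\dots,x_{(a-1)l+m}\}$, $1\le a\le n/l$, indices being read modulo $n$. A run of length $q\ge 1$ is a complex with $(q-1)l+m$ vertices that can be labelled $y_1,y_2,\dots,y_{(q-1)l+m}$ so that it is generated by its $q$ facets $\{y_{(a-1)l+1},\dots,y_{(a-1)l+m}\}$, $1\le a\le q$; such a labelling is called standard, and it orders the facets. Let $\Gamma$ be a subcollection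 of $\Delta_{m,l}(C_n)$ whose connected components are runs $R_1,\dots,R_r$ of lengths $s_1,\dots,s_r$, with chosen standard labellings. Let $V=V(\Gamma)$ be its vertex set and let $$\mathcal E=E(s_1,\dots,s_r)=\langle F_V^c : F \text{ a facet of }\Gamma\rangle .$$ Write $s_j=p_j(t+1)+d_j$ with $p_j\ge 0$ and $0\le d_j\le t$. **Proposition 4.3.** For every $1\le j\le r$ and every integer $i$ the following hold. Let $\mathcal F_j$ be the set of facets of the runs $R_h$, $h\ne j$, and let $F_{j,1},\dots,F_{j,s_j}$ be the facets of $R_j$ in the order of its standard labelling. 1. If $s_j\ge t+2$, then $$\widetilde H_i(\mathcal E)\cong\widetilde H_{i-2p_j}\big(\big\langle F_W^c : F\in\mathcal F_j\cup\{F_{j,p_j(t+1)+1},\dots,F_{j,p_j(t+1)+d_j}\}\big\rangle\big),$$ where $W=V\setminus A$ and $A$ is the union of the first $(p_j-1)(t+1)+2$ facets of $R_j$. 2. If $s_j=2$ and $r\ge 2$, then $\widetilde H_i(\mathcal E)\cong\widetilde H_{i-2}(\langle F_W^c : F\in\mathcal F_j\rangle)$, where $W$ is the vertex set of $\langle \mathcal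 F_j\rangle$. 3. If $s_j=1$ and $r\ge 2$, then $\widetilde H_i(\mathcal E)\cong\widetilde H_{i-1}(\langle F_W^c : F\in\mathcal F_j\rangle)$, where $W$ is the vertex set of $\langle \mathcal F_j\rangle$. 4. If $d_j\notin\{1,2\}$, then $\widetilde H_i(\mathcal E)=0$. -/

import Mathlib

/-! # Simplicial complexes

A simplicial complex with vertices in `V` is a family of finite subsets of `V` closed under passing
to subsets, that is, a `LowerSet (Finset V)`.  The void complex `∅ = ⟨⟩` (no face at all) and the
complex `{∅}` are different complexes. -/

namespace PathRuns

/-- The simplicial complex `⟨F₁, …, F_q⟩` generated by a collection of finite sets. -/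
def generated {V : Type*} (𝓕 : Set (Finset V)) : LowerSet (Finset V) :=
  lowerClosure 𝓕

/-- The set of facets of a simplicial complex: the faces that are maximal under inclusion. -/
def facets {V : Type*} (Δ : LowerSet (Finset V)) : Set (Finset V) :=
  {F | Maximal (fun G => G ∈ Δ) F}

open Classical in
/-- The vertex set `V(Δ)`. -/
noncomputable def vertexSet {V : Type*} [Fintype V] (Δ : LowerSet (Finset V)) : Finset V :=
  Finset.univ.filter (fun v => {v} ∈ Δ)

/-- A subcollection of `Δ` is a simplicial complex whose facets are also facets of `Δ`. -/
def IsSubcollection {V : Type*} (Γ Δ : LowerSet (Finset V)) : Prop :=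
  facets Γ ⊆ facets Δ

/-- The complex `⟨(F₁)_W^c, …, (F_q)_W^c⟩` generated by the complements `F_W^c = W \ F` of the
members `F` of a collection. -/
def complementComplex {V : Type*} [DecidableEq V] (W : Finset V) (𝓕 : Set (Finset V)) :
    LowerSet (Finset V) :=
  generated ((fun F => W \ F) '' 𝓕)

/-- The complex `Γ_Y^c`, `Y = V(Γ)`, generated by the complements in `V(Γ)` of the facets of `Γ`.
If `Γ` is a disjoint union of runs of lengths `s₁, …, s_r`, this is `E(s₁, …, s_r)`. -/
noncomputable def facetComplement {V : Type*} [Fintype V] [DecidableEq V]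
    (Γ : LowerSet (Finset V)) : LowerSet (Finset V) :=
  complementComplex (vertexSet Γ) (facets Γ)

/-! # Reduced simplicial homology

Faces are oriented by a fixed linear order on the finite vertex set `V`.  A chain
`∑ c_F F` is written as its coefficient function `c : Finset V → K`.  The empty face spans
degree `-1`. -/

/-- The number of elements of `F` that are smaller than `v`.  For `v ∈ F` this is the position of
`v` in `F`, counted from `0` in increasing order. -/
def position {V : Type*} [LinearOrder V] (F : Finset V) (v : V) : ℕ :=
  (F.filter (fun w => w < v)).card

/-- The simplicial boundary `∂[v₀, …, v_q] = ∑ₐ (-1)ᵃ [v₀, …, v̂ₐ, …, v_q]` for `v₀ < ⋯ < v_q`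
(so `∂[v] = ∅` and `∂∅ = 0`), extended linearly.  In coefficients: `G` occurs in the boundary of the
faces `G ∪ {v}`, `v ∉ G`, with the sign given by the position of `v`.  The lemma `boundary_single`
below is the formula on faces. -/
def boundary (K : Type*) [Field K] (V : Type*) [Fintype V] [LinearOrder V] :
    (Finset V → K) →ₗ[K] (Finset V → K) where
  toFun c G := ∑ v ∈ Gᶜ, (-1 : K) ^ position G v * c (insert v G)
  map_add' c c' := by
    funext G
    simp [mul_add, Finset.sum_add_distrib]
  map_smul' a c := by
    funext G
    simp only [Pi.smul_apply, smul_eq_mul, RingHom.id_apply, Finset.mul_sum]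
    exact Finset.sum_congr rfl (fun v _ => by ring)

/-- The chains `C_i(Δ)` of degree `i`: linear combinations of the faces with `i + 1` vertices. -/
def chains (K : Type*) [Field K] {V : Type*} (Δ : LowerSet (Finset V)) (i : ℤ) :
    Submodule K (Finset V → K) where
  carrier := {c | ∀ F, c F ≠ 0 → F ∈ Δ ∧ (F.card : ℤ) = i + 1}
  zero_mem' F h := absurd rfl h
  add_mem' {c c'} hc hc' F h := by
    by_cases h0 : c F = 0
    · exact hc' F (fun h1 => h (by simp [h0, h1]))
    · exact hc F h0
  smul_mem' a c hc F h := hc F (fun h0 => h (by simp [h0]))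

/-- The cycles `Z_i(Δ)`. -/
def cycles (K : Type*) [Field K] {V : Type*} [Fintype V] [LinearOrder V]
    (Δ : LowerSet (Finset V)) (i : ℤ) : Submodule K (Finset V → K) :=
  chains K Δ i ⊓ LinearMap.ker (boundary K V)

/-- The boundaries `B_i(Δ) = ∂ C_{i+1}(Δ)`. -/
def boundaries (K : Type*) [Field K] {V : Type*} [Fintype V] [LinearOrder V]
    (Δ : LowerSet (Finset V)) (i : ℤ) : Submodule K (Finset V → K) :=
  (chains K Δ (i + 1)).map (boundary K V)

/-- The reduced homology `H̃_i(Δ) = Z_i(Δ) / B_i(Δ)` with coefficients in the field `K`.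
The lemma `boundaries_le_cycles` below records that `B_i(Δ) ⊆ Z_i(Δ)`. -/
abbrev ReducedHomology (K : Type*) [Field K] {V : Type*} [Fintype V] [LinearOrder V]
    (Δ : LowerSet (Finset V)) (i : ℤ) : Type _ :=
  cycles K Δ i ⧸ (boundaries K Δ i).submoduleOf (cycles K Δ i)

theorem boundary_single (K : Type*) [Field K] {V : Type*} [Fintype V] [LinearOrder V]
    (F : Finset V) :
    boundary K V (Pi.single F 1) =
      ∑ v ∈ F, (-1 : K) ^ position F v • Pi.single (F.erase v) (1 : K) := by
  have key : ∀ v ∈ F, position (F.erase v) v = position F v := by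
    intro v _
    unfold position
    congr 1
    ext u
    simp only [Finset.mem_filter, Finset.mem_erase]
    exact ⟨fun h => ⟨h.1.2, h.2⟩, fun h => ⟨⟨h.2.ne, h.1⟩, h.2⟩⟩
  funext G
  change ∑ v ∈ Gᶜ, (-1 : K) ^ position G v * (Pi.single F 1 : Finset V → K) (insert v G) = _
  rw [Finset.sum_apply]
  have h1 : ∀ v, v ∈ Gᶜ ∧ insert v G = F ↔ v ∈ F ∧ G = F.erase v := by
    intro v
    rw [Finset.mem_compl]
    constructor
    · rintro ⟨hv, rfl⟩
      exact ⟨Finset.mem_insert_self _ _, (Finset.erase_insert hv).symm⟩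
    · rintro ⟨hv, rfl⟩
      exact ⟨Finset.notMem_erase _ _, Finset.insert_erase hv⟩
  simp only [Pi.smul_apply, Pi.single_apply, smul_eq_mul, mul_ite, mul_one, mul_zero]
  rw [← Finset.sum_filter, ← Finset.sum_filter]
  refine Finset.sum_congr ?_ ?_
  · ext v
    rw [Finset.mem_filter, Finset.mem_filter]
    exact h1 v
  · intro v hv
    rw [Finset.mem_filter] at hv
    rw [hv.2, key v hv.1]

theorem position_insert {V : Type*} [LinearOrder V] {G : Finset V} {v w : V}
    (hv : v ∉ G) (h : v < w) :
    position (insert v G) w = position G w + 1 ∧ position (insert w G) v = position G v := by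
  unfold position
  rw [Finset.filter_insert, if_pos h, Finset.filter_insert, if_neg h.asymm]
  exact ⟨Finset.card_insert_of_notMem (by simp [hv]), rfl⟩

theorem boundary_boundary {K : Type*} [Field K] {V : Type*} [Fintype V] [LinearOrder V]
    (c : Finset V → K) : boundary K V (boundary K V c) = 0 := by
  funext G
  change ∑ v ∈ Gᶜ, (-1 : K) ^ position G v * (∑ w ∈ (insert v G)ᶜ,
    (-1 : K) ^ position (insert v G) w * c (insert w (insert v G))) = 0
  simp only [Finset.mul_sum]
  rw [Finset.sum_sigma']
  refine Finset.sum_involution (fun q _ => ⟨q.2, q.1⟩) ?_ ?_ ?_ ?_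
  · rintro ⟨v, w⟩ h
    simp only [Finset.mem_sigma, Finset.mem_compl, Finset.mem_insert, not_or] at h
    obtain ⟨hv, hwv, hw⟩ := h
    dsimp only
    rw [Finset.insert_comm v w]
    rcases lt_or_gt_of_ne hwv with hlt | hlt
    · obtain ⟨h1, h2⟩ := position_insert hw hlt
      rw [h1, h2]; ring
    · obtain ⟨h1, h2⟩ := position_insert hv hlt
      rw [h1, h2]; ring
  · rintro ⟨v, w⟩ h _ he
    simp only [Finset.mem_sigma, Finset.mem_compl, Finset.mem_insert, not_or] at h
    simp only [Sigma.mk.injEq] at he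
    exact h.2.1 he.1
  · rintro ⟨v, w⟩ h
    simp only [Finset.mem_sigma, Finset.mem_compl, Finset.mem_insert, not_or] at h ⊢
    exact ⟨h.2.2, Ne.symm h.2.1, h.1⟩
  · rintro ⟨v, w⟩ _
    rfl

theorem boundaries_le_cycles (K : Type*) [Field K] {V : Type*} [Fintype V] [LinearOrder V]
    (Δ : LowerSet (Finset V)) (i : ℤ) : boundaries K Δ i ≤ cycles K Δ i := by
  rintro _ ⟨c, hc, rfl⟩
  refine ⟨?_, boundary_boundary c⟩
  intro G hG
  obtain ⟨v, hv, hne⟩ := Finset.exists_ne_zero_of_sum_ne_zero hG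
  obtain ⟨h1, h2⟩ := hc (insert v G) (right_ne_zero_of_mul hne)
  refine ⟨Δ.lower (Finset.subset_insert v G) h1, ?_⟩
  rw [Finset.card_insert_of_notMem (Finset.mem_compl.1 hv)] at h2
  push_cast at h2
  linarith

/-! # Path complexes of cycles, and runs

Vertices and facets are counted from `0`: the vertex `x_{a+1}` and the facet `F_{i+1}` of the usual
`1`-based notation are the vertex `a` and the facet `i` here. -/

/-- The facet `i` of `Δ_{m,l}(C_n)`: the vertices `i l, i l + 1, …, i l + m - 1` modulo `n`. -/
def cycleFacet (n l m : ℕ) (i : ℕ) : Finset (Fin n) :=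
  Finset.univ.filter (fun v => ∃ a < m, (v : ℕ) = (i * l + a) % n)

/-- The path complex `Δ_{m,l}(C_n)` of the `n`-cycle, for a divisor `l` of `n`; it is generated by
the facets `0, …, n / l - 1`. -/
def cyclePathComplex (n l m : ℕ) : LowerSet (Finset (Fin n)) :=
  generated {F | ∃ i < n / l, F = cycleFacet n l m i}

/-- The facet `i` of the path complex of a line whose vertices are labelled
`x 0, x 1, x 2, …`, in this order: the set `{x (i l), x (i l + 1), …, x (i l + m - 1)}`. -/
def runFacet {V : Type*} [DecidableEq V] (l m : ℕ) (x : ℕ → V) (i : ℕ) : Finset V :=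
  (Finset.Ico (i * l) (i * l + m)).image x

/-- `R` is a run of length `q ≥ 1` with standard labelling `x`: the labels
`x 0, …, x ((q - 1) l + m - 1)` are distinct vertices, and `R` is the path complex
`Δ_{m,l}(L_{q l + (m - l)})` of the line they form, with the facets `0, …, q - 1`.
The values of `x` outside this range play no role. -/
structure IsRun {V : Type*} [DecidableEq V] (l m q : ℕ) (x : ℕ → V)
    (R : LowerSet (Finset V)) : Prop where
  pos : 0 < q
  injOn : Set.InjOn x (Set.Iio ((q - 1) * l + m))
  eq : R = generated {F | ∃ i < q, F = runFacet l m x i}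

/-- `Γ` is the disjoint union of the runs `R 0, …, R (r - 1)` of lengths `len 0, …, len (r - 1)`,
with standard labellings `x 0, …, x (r - 1)`.  For `0 < l < m` consecutive facets of a run meet, so
runs are connected and the `R j` are exactly the connected components of `Γ`. -/
structure IsDisjointUnionOfRuns {V : Type*} [Fintype V] [DecidableEq V] (l m : ℕ)
    (Γ : LowerSet (Finset V)) {r : ℕ} (R : Fin r → LowerSet (Finset V)) (len : Fin r → ℕ)
    (x : Fin r → ℕ → V) : Prop where
  isRun : ∀ j, IsRun l m (len j) (x j) (R j)
  disjoint : ∀ j j', j ≠ j' → Disjoint (vertexSet (R j)) (vertexSet (R j'))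
  union : Γ = ⨆ j, R j

/-- The facets of all the components `R j'` other than `R j`. -/
def otherFacets {V : Type*} {r : ℕ} (R : Fin r → LowerSet (Finset V)) (j : Fin r) :
    Set (Finset V) :=
  {F | ∃ j', j' ≠ j ∧ F ∈ facets (R j')}

/-- The vertex set of the subcollection formed by the front (that is, first) `b` facets of the run
labelled by `x`. -/
def frontVertices {V : Type*} [DecidableEq V] (l m : ℕ) (x : ℕ → V) (b : ℕ) : Finset V :=
  (Finset.range b).biUnion (runFacet l m x)

end PathRuns

/-!
Write `D(W, 𝓕)` for the complex generated by the complements `W \ F`, `F ∈ 𝓕`.  If `v ∈ W` lies in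
no member of `𝓕`, then `D(W, 𝓕)` is a cone with apex `v`, hence acyclic.  If moreover `F` does not
contain `W`, then `D(W, 𝓕 ∪ {F})` is the union of this cone and the full simplex on `W \ F`, which
meet in `D(W \ F, 𝓕)`; by Mayer–Vietoris, deleting `F` shifts the homology by one.

In a run, the label `x (c l + s)` lies in the facet `c` and in no later one.  Once the vertices of
the facet `c` are deleted, what is left of the facet `c + 1` is contained in each of the facets
`c + 2, …, c + t`, which become redundant, and `x (c l + m)` lies in the facet `c + 1` and in none
of the facets from `c + t + 1` on.  Thus `t + 1` facets disappear at the cost of a shift by two.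
If this exhausts the facets before the vertices of the run, a cone remains.
-/

namespace PathRuns

section Subquotient

variable {A M N : Type*} [Ring A] [AddCommGroup M] [Module A M] [AddCommGroup N] [Module A N]

theorem nonempty_subquotient_equiv {Z B : Submodule A M} {Z' B' : Submodule A N} (f : M →ₗ[A] N)
    (map_mem : ∀ z ∈ Z, f z ∈ Z') (map_mem_iff : ∀ z ∈ Z, f z ∈ B' ↔ z ∈ B)
    (exists_sub_mem : ∀ z' ∈ Z', ∃ z ∈ Z, f z - z' ∈ B') :
    Nonempty ((Z ⧸ B.submoduleOf Z) ≃ₗ[A] (Z' ⧸ B'.submoduleOf Z')) := by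
  let g : Z →ₗ[A] (Z' ⧸ B'.submoduleOf Z') := (B'.submoduleOf Z').mkQ ∘ₗ f.restrict map_mem
  have ker_g : LinearMap.ker g = B.submoduleOf Z := by
    ext z
    exact (Submodule.Quotient.mk_eq_zero _).trans (map_mem_iff z z.2)
  have surjective_g : Function.Surjective g := by
    intro y
    obtain ⟨z', rfl⟩ := Submodule.Quotient.mk_surjective _ y
    obtain ⟨z, hz, h⟩ := exists_sub_mem z' z'.2
    exact ⟨⟨z, hz⟩, (Submodule.Quotient.eq _).2 h⟩
  exact ⟨(Submodule.quotEquivOfEq _ _ ker_g.symm).trans (g.quotKerEquivOfSurjective surjective_g)⟩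

end Subquotient

/-! ### Acyclic complexes -/

section Chains

variable {K : Type*} [Field K] {V : Type*} {Δ Δ' : LowerSet (Finset V)} {i : ℤ}
  {c : Finset V → K}

theorem chains_mono (h : Δ ≤ Δ') : chains K Δ i ≤ chains K Δ' i :=
  fun _ hc F hF => ⟨h (hc F hF).1, (hc F hF).2⟩

theorem chains_inf : chains K (Δ ⊓ Δ') i = chains K Δ i ⊓ chains K Δ' i :=
  le_antisymm (le_inf (chains_mono inf_le_left) (chains_mono inf_le_right))
    fun _ hc F hF => ⟨⟨(hc.1 F hF).1, (hc.2 F hF).1⟩, (hc.1 F hF).2⟩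

variable (K Δ) in
/-- The restriction of chains to the faces in `Δ`. -/
noncomputable def restrict : (Finset V → K) →ₗ[K] (Finset V → K) where
  toFun := (Δ : Set (Finset V)).indicator
  map_add' := Set.indicator_add _
  map_smul' a c := Set.indicator_const_smul _ a c

theorem restrict_mem_chains (hc : c ∈ chains K (Δ ⊔ Δ') i) : restrict K Δ c ∈ chains K Δ i := by
  intro F hF
  have hFΔ : F ∈ Δ := Set.mem_of_indicator_ne_zero hF
  have h : restrict K Δ c F = c F := Set.indicator_of_mem hFΔ c
  exact ⟨hFΔ, (hc F (h ▸ hF)).2⟩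

theorem sub_restrict_mem_chains (hc : c ∈ chains K (Δ ⊔ Δ') i) :
    c - restrict K Δ c ∈ chains K Δ' i := by
  intro F hF
  have hFΔ : F ∉ Δ := fun h => hF (sub_eq_zero.2 (Set.indicator_of_mem h c).symm)
  have h : restrict K Δ c F = 0 := Set.indicator_of_notMem hFΔ c
  rw [Pi.sub_apply, h, sub_zero] at hF
  exact ⟨(hc F hF).1.resolve_left hFΔ, (hc F hF).2⟩

variable [Fintype V] [LinearOrder V]

theorem boundary_mem_cycles (hc : c ∈ chains K Δ (i + 1)) : boundary K V c ∈ cycles K Δ i :=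
  boundaries_le_cycles K Δ i (Submodule.mem_map_of_mem hc)

variable (K Δ) in
/-- A complex is acyclic if all its reduced homology vanishes.  This includes the void complex. -/
def IsAcyclic : Prop :=
  ∀ i, Subsingleton (ReducedHomology K Δ i)

theorem isAcyclic_iff : IsAcyclic K Δ ↔ ∀ i, cycles K Δ i ≤ boundaries K Δ i :=
  forall_congr' fun i => by
    rw [Submodule.Quotient.subsingleton_iff, Submodule.submoduleOf_eq_top]

theorem IsAcyclic.exists_boundary_eq (h : IsAcyclic K Δ) (hc : c ∈ chains K Δ i)
    (hc0 : boundary K V c = 0) : ∃ e ∈ chains K Δ (i + 1), boundary K V e = c :=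
  isAcyclic_iff.1 h i ⟨hc, hc0⟩

end Chains

section Cone

/-- `Δ` is a cone with apex `v`.  The void complex counts as a cone with any apex. -/
def IsCone {V : Type*} [DecidableEq V] (v : V) (Δ : LowerSet (Finset V)) : Prop :=
  ∀ F ∈ Δ, insert v F ∈ Δ

variable {K : Type*} [Field K] {V : Type*} [LinearOrder V] {Δ : LowerSet (Finset V)} {v : V}
  {c : Finset V → K} {i : ℤ}

/-- The join `v ∗ c` of the vertex `v` with the chain `c`; faces of `c` that contain `v`
contribute `0`. -/
def joinVertex (v : V) (c : Finset V → K) : Finset V → K :=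
  fun G => if v ∈ G then (-1) ^ position (G.erase v) v * c (G.erase v) else 0

theorem joinVertex_of_notMem {G : Finset V} (hv : v ∉ G) : joinVertex v c G = 0 :=
  if_neg hv

theorem joinVertex_insert {G : Finset V} (hv : v ∉ G) :
    joinVertex v c (insert v G) = (-1) ^ position G v * c G := by
  rw [joinVertex, if_pos (Finset.mem_insert_self v G), Finset.erase_insert hv]

theorem IsCone.joinVertex_mem_chains (h : IsCone v Δ) (hc : c ∈ chains K Δ i) :
    joinVertex v c ∈ chains K Δ (i + 1) := by
  intro G hG
  have hvG : v ∈ G := by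
    by_contra hvG
    exact hG (joinVertex_of_notMem hvG)
  rw [← Finset.insert_erase hvG, joinVertex_insert (Finset.notMem_erase v G)] at hG
  obtain ⟨hGΔ, hcard⟩ := hc _ (right_ne_zero_of_mul hG)
  refine ⟨Finset.insert_erase hvG ▸ h _ hGΔ, ?_⟩
  rw [← hcard, ← Finset.card_erase_add_one hvG, Nat.cast_add_one]

variable [Fintype V]

theorem boundary_apply_of_notMem (hc : ∀ F, v ∉ F → c F = 0) {G : Finset V} (hv : v ∉ G) :
    boundary K V c G = (-1) ^ position G v * c (insert v G) := by
  refine Finset.sum_eq_single_of_mem v (Finset.mem_compl.2 hv) fun u _ huv => ?_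
  rw [hc _ (by simp [huv.symm, hv]), mul_zero]

theorem boundary_joinVertex_of_notMem {G : Finset V} (hv : v ∉ G) :
    boundary K V (joinVertex v c) G = c G := by
  rw [boundary_apply_of_notMem (fun _ => joinVertex_of_notMem) hv, joinVertex_insert hv,
    ← mul_assoc, ← mul_pow, neg_one_mul, neg_neg, one_pow, one_mul]

theorem boundary_joinVertex (hc : boundary K V c = 0) : boundary K V (joinVertex v c) = c := by
  -- The difference `e` is a cycle supported on faces containing `v`; its boundary has the
  -- coefficient `± e (insert v G)` at a face `G` that does not contain `v`.
  set e := boundary K V (joinVertex v c) - c with he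
  have e_notMem : ∀ G, v ∉ G → e G = 0 := fun G hv =>
    sub_eq_zero.2 (boundary_joinVertex_of_notMem hv)
  have boundary_e : boundary K V e = 0 := by
    rw [he, map_sub, boundary_boundary, hc, sub_zero]
  refine sub_eq_zero.1 (funext fun G => ?_)
  by_cases hv : v ∈ G
  · have h := boundary_apply_of_notMem e_notMem (Finset.notMem_erase v G)
    rw [boundary_e, Finset.insert_erase hv] at h
    exact (mul_eq_zero.1 h.symm).resolve_left (pow_ne_zero _ (neg_ne_zero.2 one_ne_zero))
  · exact e_notMem G hv

theorem IsCone.isAcyclic (h : IsCone v Δ) : IsAcyclic K Δ :=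
  isAcyclic_iff.2 fun _ c hc => ⟨joinVertex v c, h.joinVertex_mem_chains hc.1,
    boundary_joinVertex hc.2⟩

end Cone

section MayerVietoris

variable {K : Type*} [Field K] {V : Type*} [Fintype V] [LinearOrder V]
  {Δ Δ' : LowerSet (Finset V)} {i : ℤ} {z : Finset V → K}

/- The connecting homomorphism of the Mayer–Vietoris sequence of `Δ` and `Δ'` is induced by
`z ↦ ∂ (z|Δ)`. -/

theorem boundary_restrict_mem_cycles (hz : z ∈ cycles K (Δ ⊔ Δ') (i + 1)) :
    boundary K V (restrict K Δ z) ∈ cycles K (Δ ⊓ Δ') i := by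
  have h := boundary_mem_cycles (restrict_mem_chains hz.1)
  have h' := boundary_mem_cycles (sub_restrict_mem_chains hz.1)
  rw [map_sub, LinearMap.mem_ker.1 hz.2, zero_sub, neg_mem_iff] at h'
  exact ⟨chains_inf.ge ⟨h.1, h'.1⟩, h.2⟩

theorem boundary_restrict_mem_boundaries_iff (hΔ : IsAcyclic K Δ) (hΔ' : IsAcyclic K Δ')
    (hz : z ∈ cycles K (Δ ⊔ Δ') (i + 1)) :
    boundary K V (restrict K Δ z) ∈ boundaries K (Δ ⊓ Δ') i ↔
      z ∈ boundaries K (Δ ⊔ Δ') (i + 1) := by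
  have restrict_mem := restrict_mem_chains hz.1
  have sub_mem' := sub_restrict_mem_chains hz.1
  constructor
  · rintro ⟨e, he, he_eq⟩
    rw [SetLike.mem_coe, chains_inf] at he
    obtain ⟨b, hb, hb_eq⟩ := hΔ.exists_boundary_eq (sub_mem restrict_mem he.1)
      (by rw [map_sub, he_eq, sub_self])
    obtain ⟨b', hb', hb'_eq⟩ := hΔ'.exists_boundary_eq (add_mem sub_mem' he.2)
      (by rw [map_add, map_sub, he_eq, LinearMap.mem_ker.1 hz.2]; abel)
    refine ⟨b + b', add_mem (chains_mono le_sup_left hb) (chains_mono le_sup_right hb'), ?_⟩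
    rw [map_add, hb_eq, hb'_eq]
    abel
  · rintro ⟨w, hw, rfl⟩
    have hb := (boundary_mem_cycles (restrict_mem_chains hw)).1
    have hb' := (boundary_mem_cycles (sub_restrict_mem_chains hw)).1
    set b := boundary K V (restrict K Δ w) with hb_eq
    refine ⟨restrict K Δ (boundary K V w) - b, chains_inf.ge ⟨sub_mem restrict_mem hb, ?_⟩, ?_⟩
    · have sub_eq : restrict K Δ (boundary K V w) - b =
          boundary K V (w - restrict K Δ w) -
            (boundary K V w - restrict K Δ (boundary K V w)) := by
        rw [map_sub]
        abel
      rw [sub_eq]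
      exact sub_mem hb' sub_mem'
    · rw [map_sub, hb_eq, boundary_boundary, sub_zero]

theorem exists_boundary_restrict_sub_mem_boundaries (hΔ : IsAcyclic K Δ) (hΔ' : IsAcyclic K Δ')
    {y : Finset V → K} (hy : y ∈ cycles K (Δ ⊓ Δ') i) :
    ∃ z ∈ cycles K (Δ ⊔ Δ') (i + 1),
      boundary K V (restrict K Δ z) - y ∈ boundaries K (Δ ⊓ Δ') i := by
  obtain ⟨hyc, hy0⟩ := hy
  rw [SetLike.mem_coe, chains_inf] at hyc
  obtain ⟨a, ha, rfl⟩ := hΔ.exists_boundary_eq hyc.1 hy0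
  obtain ⟨a', ha', ha'_eq⟩ := hΔ'.exists_boundary_eq hyc.2 hy0
  have hz : a - a' ∈ chains K (Δ ⊔ Δ') (i + 1) :=
    sub_mem (chains_mono le_sup_left ha) (chains_mono le_sup_right ha')
  refine ⟨a - a', ⟨hz, ?_⟩, restrict K Δ (a - a') - a, chains_inf.ge ⟨?_, ?_⟩, map_sub _ _ _⟩
  · rw [SetLike.mem_coe, LinearMap.mem_ker, map_sub, ha'_eq, sub_self]
  · exact sub_mem (restrict_mem_chains hz) ha
  · have sub_eq : restrict K Δ (a - a') - a = -(a - a' - restrict K Δ (a - a') + a') := by abel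
    rw [sub_eq]
    exact neg_mem (add_mem (sub_restrict_mem_chains hz) ha')

theorem IsAcyclic.nonempty_sup_equiv_inf (hΔ : IsAcyclic K Δ) (hΔ' : IsAcyclic K Δ') (i : ℤ) :
    Nonempty (ReducedHomology K (Δ ⊔ Δ') i ≃ₗ[K] ReducedHomology K (Δ ⊓ Δ') (i - 1)) := by
  obtain ⟨k, rfl⟩ : ∃ k, i = k + 1 := ⟨i - 1, (sub_add_cancel i 1).symm⟩
  rw [add_sub_cancel_right]
  exact nonempty_subquotient_equiv (boundary K V ∘ₗ restrict K Δ)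
    (fun _ => boundary_restrict_mem_cycles)
    (fun _ => boundary_restrict_mem_boundaries_iff hΔ hΔ')
    (fun _ => exists_boundary_restrict_sub_mem_boundaries hΔ hΔ')

end MayerVietoris

/-! ### Complexes generated by complements -/

section ComplementComplex

variable {V : Type*} [DecidableEq V] {W F : Finset V} {𝓕 𝓖 : Set (Finset V)} {v : V}

theorem mem_complementComplex {G : Finset V} :
    G ∈ complementComplex W 𝓕 ↔ G ⊆ W ∧ ∃ F ∈ 𝓕, Disjoint G F := by
  simp only [complementComplex, generated, mem_lowerClosure, Set.exists_mem_image,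
    Finset.subset_sdiff]
  tauto

theorem complementComplex_insert :
    complementComplex W (insert F 𝓕) = LowerSet.Iic (W \ F) ⊔ complementComplex W 𝓕 := by
  rw [complementComplex, generated, Set.image_insert_eq, Set.insert_eq, lowerClosure_union,
    lowerClosure_singleton]
  rfl

theorem Iic_inf_complementComplex :
    LowerSet.Iic (W \ F) ⊓ complementComplex W 𝓕 = complementComplex (W \ F) 𝓕 := by
  ext G
  simp only [LowerSet.mem_inf_iff, LowerSet.mem_Iic_iff, mem_complementComplex, SetLike.mem_coe]
  exact ⟨fun h => ⟨h.1, h.2.2⟩, fun h => ⟨h.1, h.1.trans Finset.sdiff_subset, h.2⟩⟩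

theorem complementComplex_eq_of_subset (h𝓕 : 𝓕 ⊆ 𝓖) (h𝓖 : ∀ G ∈ 𝓖, ∃ F ∈ 𝓕, W ∩ F ⊆ G) :
    complementComplex W 𝓖 = complementComplex W 𝓕 := by
  refine le_antisymm (lowerClosure_le.2 ?_) (lowerClosure_mono (Set.image_mono h𝓕))
  rintro _ ⟨G, hG, rfl⟩
  obtain ⟨F, hF, hFG⟩ := h𝓖 G hG
  refine mem_complementComplex.2 ⟨Finset.sdiff_subset, F, hF, ?_⟩
  rw [Finset.disjoint_left]
  intro w hw hwF
  rw [Finset.mem_sdiff] at hw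
  exact hw.2 (hFG (Finset.mem_inter.2 ⟨hw.1, hwF⟩))

theorem isCone_Iic (hv : v ∈ W) : IsCone v (LowerSet.Iic W) :=
  fun _ hG => Finset.insert_subset hv hG

theorem isCone_complementComplex (hvW : v ∈ W) (hv : ∀ F ∈ 𝓕, v ∉ F) :
    IsCone v (complementComplex W 𝓕) := by
  intro G hG
  obtain ⟨hGW, F, hF, hGF⟩ := mem_complementComplex.1 hG
  exact mem_complementComplex.2 ⟨Finset.insert_subset hvW hGW, F, hF,
    Finset.disjoint_insert_left.2 ⟨hv F hF, hGF⟩⟩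

theorem nonempty_complementComplex_insert_equiv (K : Type*) [Field K] {V : Type*} [Fintype V]
    [LinearOrder V] {W F : Finset V} {𝓕 : Set (Finset V)} {v : V} (hvW : v ∈ W)
    (hv : ∀ F' ∈ 𝓕, v ∉ F') (hWF : (W \ F).Nonempty) (i : ℤ) :
    Nonempty (ReducedHomology K (complementComplex W (insert F 𝓕)) i ≃ₗ[K]
      ReducedHomology K (complementComplex (W \ F) 𝓕) (i - 1)) := by
  obtain ⟨u, hu⟩ := hWF
  rw [complementComplex_insert, ← Iic_inf_complementComplex]
  exact (isCone_Iic hu).isAcyclic.nonempty_sup_equiv_inf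
    (isCone_complementComplex hvW hv).isAcyclic i

end ComplementComplex

section Facets

variable {V : Type*} {Δ : LowerSet (Finset V)} {𝓕 : Set (Finset V)}

theorem facets_generated (h : IsAntichain (· ⊆ ·) 𝓕) : facets (generated 𝓕) = 𝓕 :=
  Set.ext fun _ => h.maximal_mem_lowerClosure_iff_mem

theorem generated_facets [Finite V] (Δ : LowerSet (Finset V)) : generated (facets Δ) = Δ := by
  refine le_antisymm (lowerClosure_le.2 fun F hF => hF.prop) fun F hF => ?_
  obtain ⟨G, hFG, hG⟩ := Finite.exists_le_maximal hF
  exact mem_lowerClosure.2 ⟨G, hG, hFG⟩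

variable [Fintype V] {v : V}

theorem mem_vertexSet : v ∈ vertexSet Δ ↔ {v} ∈ Δ := by
  simp only [vertexSet, Finset.mem_filter_univ]

theorem mem_vertexSet_generated : v ∈ vertexSet (generated 𝓕) ↔ ∃ F ∈ 𝓕, v ∈ F := by
  simp only [mem_vertexSet, generated, mem_lowerClosure, Finset.singleton_subset_iff]

theorem mem_vertexSet_iff_exists_facet : v ∈ vertexSet Δ ↔ ∃ F ∈ facets Δ, v ∈ F := by
  rw [← mem_vertexSet_generated, generated_facets]

end Facets

/-! ### Runs -/

section Run

variable {V : Type*} [DecidableEq V] {l m q : ℕ} {x : ℕ → V} {a b c k : ℕ}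

/-- The facets `c, …, q - 1` of a run of length `q` labelled by `x`. -/
def backFacets (l m : ℕ) (x : ℕ → V) (c q : ℕ) : Set (Finset V) :=
  {F | ∃ a, c ≤ a ∧ a < q ∧ F = runFacet l m x a}

theorem backFacets_eq_insert (hcq : c < q) :
    backFacets l m x c q = insert (runFacet l m x c) (backFacets l m x (c + 1) q) := by
  ext F
  constructor
  · rintro ⟨a, hca, haq, rfl⟩
    rcases hca.eq_or_lt with rfl | hca
    · exact Set.mem_insert _ _
    · exact Set.mem_insert_of_mem _ ⟨a, hca, haq, rfl⟩
  · rintro (rfl | ⟨a, hca, haq, rfl⟩)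
    · exact ⟨c, le_rfl, hcq, rfl⟩
    · exact ⟨a, c.le_succ.trans hca, haq, rfl⟩

theorem backFacets_eq_empty (hqc : q ≤ c) : backFacets l m x c q = ∅ :=
  Set.eq_empty_iff_forall_notMem.2 fun _ ⟨_, hca, haq, _⟩ => (hqc.trans hca).not_gt haq

theorem mem_runFacet {v : V} :
    v ∈ runFacet l m x a ↔ ∃ k, a * l ≤ k ∧ k < a * l + m ∧ x k = v := by
  simp only [runFacet, Finset.mem_image, Finset.mem_Ico, and_assoc]

theorem facet_le (ha : a < q) : a * l + m ≤ (q - 1) * l + m :=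
  Nat.add_le_add_right (Nat.mul_le_mul_right l (Nat.le_sub_one_of_lt ha)) m

theorem label_mem_runFacet (hx : Set.InjOn x (Set.Iio ((q - 1) * l + m))) (ha : a < q)
    (hk : k < (q - 1) * l + m) : x k ∈ runFacet l m x a ↔ a * l ≤ k ∧ k < a * l + m := by
  rw [mem_runFacet]
  constructor
  · rintro ⟨k', hak', hk'a, hkk'⟩
    rw [← hx (hk'a.trans_le (facet_le ha)) hk hkk']
    exact ⟨hak', hk'a⟩
  · rintro ⟨hak, hka⟩
    exact ⟨k, hak, hka, rfl⟩

theorem card_runFacet (hx : Set.InjOn x (Set.Iio ((q - 1) * l + m))) (ha : a < q) :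
    (runFacet l m x a).card = m := by
  have injOn : Set.InjOn x (Finset.Ico (a * l) (a * l + m)) :=
    hx.mono fun k hk => (Finset.mem_Ico.1 hk).2.trans_le (facet_le ha)
  rw [runFacet, Finset.card_image_of_injOn injOn, Nat.card_Ico, Nat.add_sub_cancel_left]

theorem frontVertices_one : frontVertices l m x 1 = runFacet l m x 0 := by
  rw [frontVertices, Finset.range_one, Finset.singleton_biUnion]

theorem frontVertices_two :
    frontVertices l m x 2 = runFacet l m x 0 ∪ runFacet l m x 1 := by
  rw [frontVertices, Finset.range_add_one, Finset.biUnion_insert, Finset.range_one,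
    Finset.singleton_biUnion, Finset.union_comm]

theorem frontVertices_succ (hlm : l ≤ m) (b : ℕ) :
    frontVertices l m x (b + 1) = (Finset.range (b * l + m)).image x := by
  induction b with
  | zero => rw [zero_add, frontVertices_one, runFacet, zero_mul, zero_add, Finset.range_eq_Ico]
  | succ b ih =>
    have range_eq : Finset.range ((b + 1) * l + m) =
        Finset.Ico ((b + 1) * l) ((b + 1) * l + m) ∪ Finset.range (b * l + m) := by
      ext k
      simp only [Finset.mem_union, Finset.mem_Ico, Finset.mem_range, Nat.succ_mul]
      omega
    rw [frontVertices, Finset.range_add_one, Finset.biUnion_insert, ← frontVertices, ih, range_eq,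
      Finset.image_union, runFacet]

theorem label_notMem_frontVertices (hx : Set.InjOn x (Set.Iio ((q - 1) * l + m))) (hlm : l ≤ m)
    (hk : k < (q - 1) * l + m) (hbk : b * l + m ≤ k) : x k ∉ frontVertices l m x (b + 1) := by
  rw [frontVertices_succ hlm, Finset.mem_image]
  rintro ⟨k', hk', hkk'⟩
  rw [Finset.mem_range] at hk'
  exact (hk'.trans_le hbk).ne (hx ((hk'.trans_le hbk).trans hk) hk hkk')

theorem last_label_mem_sdiff_frontVertices {W : Finset V} (hl : 0 < l) (hlm : l ≤ m)
    (hx : Set.InjOn x (Set.Iio ((q - 1) * l + m))) (hW : ∀ k < (q - 1) * l + m, x k ∈ W)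
    (hbq : b + 1 < q) : x ((q - 1) * l + m - 1) ∈ W \ frontVertices l m x (b + 1) := by
  have hb : (b + 1) * l + m ≤ (q - 1) * l + m := facet_le hbq
  rw [Nat.succ_mul] at hb
  rw [Finset.mem_sdiff]
  exact ⟨hW _ (by omega), label_notMem_frontVertices hx hlm (by omega) (by omega)⟩

theorem frontVertices_union_runFacet (hlm : l ≤ m) (hbc : b ≤ c) (hcb : c * l ≤ b * l + m) :
    frontVertices l m x (b + 1) ∪ (runFacet l m x c ∪ runFacet l m x (c + 1)) =
      frontVertices l m x (c + 2) := by
  have range_eq : Finset.range ((c + 1) * l + m) = Finset.range (b * l + m) ∪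
      (Finset.Ico (c * l) (c * l + m) ∪ Finset.Ico ((c + 1) * l) ((c + 1) * l + m)) := by
    have hbcl : b * l ≤ c * l := Nat.mul_le_mul_right l hbc
    ext k
    simp only [Finset.mem_union, Finset.mem_Ico, Finset.mem_range, Nat.succ_mul]
    omega
  rw [frontVertices_succ hlm, frontVertices_succ hlm, range_eq, Finset.image_union,
    Finset.image_union, runFacet, runFacet]

namespace IsRun

variable {R : LowerSet (Finset V)}

theorem facets_eq (h : IsRun l m q x R) : facets R = backFacets l m x 0 q := by
  have sized : Set.Sized m {F | ∃ a < q, F = runFacet l m x a} := by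
    rintro _ ⟨a, ha, rfl⟩
    exact card_runFacet h.injOn ha
  rw [h.eq, facets_generated sized.isAntichain]
  simp only [backFacets, Nat.zero_le, true_and]

theorem sized_facets (h : IsRun l m q x R) : (facets R).Sized m := by
  rw [h.facets_eq]
  rintro _ ⟨a, -, ha, rfl⟩
  exact card_runFacet h.injOn ha

theorem vertexSet_eq [Fintype V] (h : IsRun l m q x R) :
    vertexSet R = frontVertices l m x q := by
  ext v
  rw [h.eq, mem_vertexSet_generated, frontVertices, Finset.mem_biUnion]
  simp only [Set.mem_ofPred_eq, Finset.mem_range]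
  constructor
  · rintro ⟨_, ⟨a, ha, rfl⟩, hv⟩
    exact ⟨a, ha, hv⟩
  · rintro ⟨a, ha, hv⟩
    exact ⟨_, ⟨a, ha, rfl⟩, hv⟩

theorem label_mem_vertexSet [Fintype V] (h : IsRun l m q x R) (hlm : l ≤ m)
    (hk : k < (q - 1) * l + m) : x k ∈ vertexSet R := by
  rw [h.vertexSet_eq, ← Nat.sub_add_cancel h.pos, frontVertices_succ hlm]
  exact Finset.mem_image_of_mem _ (Finset.mem_range.2 hk)

end IsRun

end Run

/-! ### Shortening a run -/

section Shortening

variable {V : Type*} {l m q s t : ℕ} {x : ℕ → V} {𝓞 : Set (Finset V)} {W : Finset V} {c k : ℕ}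

theorem label_notMem_of_mem_union_backFacets [DecidableEq V]
    (hx : Set.InjOn x (Set.Iio ((q - 1) * l + m)))
    (h𝓞 : ∀ F ∈ 𝓞, ∀ k < (q - 1) * l + m, x k ∉ F) (hk : k < (q - 1) * l + m)
    (hkc : k < c * l) : ∀ F ∈ 𝓞 ∪ backFacets l m x c q, x k ∉ F := by
  rintro F (hF | ⟨a, hca, haq, rfl⟩)
  · exact h𝓞 F hF k hk
  · rw [label_mem_runFacet hx haq hk]
    rintro ⟨hak, -⟩
    exact (hkc.trans_le (Nat.mul_le_mul_right l hca)).not_ge hak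

/- Outside the facet `c`, the facet `c + 1` has only the labels `c l + m, …, (c + 1) l + m - 1`,
which occur in all of the facets `c + 1, …, c + t`. -/
theorem complementComplex_sdiff_runFacet [DecidableEq V] (htm : t * l ≤ m) (hcq : c + 1 < q) :
    complementComplex (W \ runFacet l m x c) (𝓞 ∪ backFacets l m x (c + 1) q) =
      complementComplex (W \ runFacet l m x c)
        (insert (runFacet l m x (c + 1)) (𝓞 ∪ backFacets l m x (c + t + 1) q)) := by
  apply complementComplex_eq_of_subset
  · rintro F (rfl | hF | ⟨a, hca, haq, rfl⟩)
    · exact Or.inr ⟨c + 1, le_rfl, hcq, rfl⟩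
    · exact Or.inl hF
    · exact Or.inr ⟨a, by omega, haq, rfl⟩
  · rintro G (hG | ⟨a, hca, haq, rfl⟩)
    · exact ⟨G, Or.inr (Or.inl hG), Finset.inter_subset_right⟩
    by_cases hat : c + t + 1 ≤ a
    · exact ⟨_, Or.inr (Or.inr ⟨a, hat, haq, rfl⟩), Finset.inter_subset_right⟩
    refine ⟨_, Set.mem_insert _ _, fun v hv => ?_⟩
    rw [Finset.mem_inter, Finset.mem_sdiff] at hv
    obtain ⟨⟨-, hvc⟩, hv⟩ := hv
    obtain ⟨k, hck, hkc, rfl⟩ := mem_runFacet.1 hv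
    rw [Nat.succ_mul] at hck hkc
    have hmk : c * l + m ≤ k := not_lt.1 fun hkm =>
      hvc (mem_runFacet.2 ⟨k, by omega, hkm, rfl⟩)
    have hal : (c + 1) * l ≤ a * l := Nat.mul_le_mul_right l hca
    have hal' : a * l ≤ (c + t) * l := Nat.mul_le_mul_right l (by omega)
    rw [Nat.succ_mul] at hal
    rw [Nat.add_mul] at hal'
    exact mem_runFacet.2 ⟨k, by omega, by omega, rfl⟩

variable [Fintype V] [LinearOrder V]

theorem nonempty_shorten_run_equiv (K : Type*) [Field K] (hs : s < l) (hmt : m = t * l + s)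
    (hx : Set.InjOn x (Set.Iio ((q - 1) * l + m)))
    (h𝓞 : ∀ F ∈ 𝓞, ∀ k < (q - 1) * l + m, x k ∉ F)
    (hW : ∀ k, c * l + s ≤ k → k < (q - 1) * l + m → x k ∈ W) (hcq : c + 2 ≤ q)
    (hne : (W \ (runFacet l m x c ∪ runFacet l m x (c + 1))).Nonempty) (i : ℤ) :
    Nonempty (ReducedHomology K (complementComplex W (𝓞 ∪ backFacets l m x c q)) i ≃ₗ[K]
      ReducedHomology K (complementComplex (W \ (runFacet l m x c ∪ runFacet l m x (c + 1)))
        (𝓞 ∪ backFacets l m x (c + t + 1) q)) (i - 2)) := by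
  have hN : c * l + l + m ≤ (q - 1) * l + m := by
    rw [← Nat.succ_mul]
    exact facet_le (by omega)
  have hsm : s ≤ m := hmt ▸ Nat.le_add_left s _
  obtain ⟨φ⟩ := nonempty_complementComplex_insert_equiv K (F := runFacet l m x c)
    (hW (c * l + s) le_rfl (by omega))
    (label_notMem_of_mem_union_backFacets hx h𝓞 (c := c + 1) (by omega)
      (by rw [Nat.succ_mul]; omega))
    (hne.mono (Finset.sdiff_subset_sdiff le_rfl Finset.subset_union_left)) i
  have hv : x (c * l + m) ∈ W \ runFacet l m x c := by
    rw [Finset.mem_sdiff, label_mem_runFacet hx (by omega) (by omega)]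
    exact ⟨hW _ (by omega) (by omega), by omega⟩
  rw [← Finset.sup_eq_union, ← sdiff_sdiff_left] at hne ⊢
  obtain ⟨ψ⟩ := nonempty_complementComplex_insert_equiv K hv
    (label_notMem_of_mem_union_backFacets hx h𝓞 (c := c + t + 1) (by omega)
      (by rw [Nat.succ_mul, Nat.add_mul]; omega)) hne (i - 1)
  rw [← Set.union_insert, ← backFacets_eq_insert (by omega),
    complementComplex_sdiff_runFacet (hmt ▸ Nat.le_add_right _ s) (by omega)] at φ
  rw [sub_sub] at ψ
  exact ⟨φ.trans ψ⟩

theorem nonempty_shorten_run_iterate_equiv (K : Type*) [Field K] (hs : s < l) (hmt : m = t * l + s)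
    (hlm : l ≤ m) (hx : Set.InjOn x (Set.Iio ((q - 1) * l + m)))
    (h𝓞 : ∀ F ∈ 𝓞, ∀ k < (q - 1) * l + m, x k ∉ F) (hW : ∀ k < (q - 1) * l + m, x k ∈ W)
    (p : ℕ) (hpq : p * (t + 1) + 3 ≤ q) (i : ℤ) :
    Nonempty (ReducedHomology K (complementComplex W (𝓞 ∪ backFacets l m x 0 q)) i ≃ₗ[K]
      ReducedHomology K (complementComplex (W \ frontVertices l m x (p * (t + 1) + 2))
        (𝓞 ∪ backFacets l m x ((p + 1) * (t + 1)) q)) (i - 2 * (p + 1))) := by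
  have hl : 0 < l := Nat.zero_lt_of_lt hs
  induction p with
  | zero =>
    have hne := last_label_mem_sdiff_frontVertices hl hlm hx hW (b := 1) (by omega)
    rw [frontVertices_two] at hne
    obtain ⟨φ⟩ := nonempty_shorten_run_equiv K hs hmt hx h𝓞 (fun k _ => hW k) (by omega)
      ⟨_, hne⟩ i
    rw [zero_add, zero_add, ← frontVertices_two] at φ
    rw [zero_mul, zero_add, zero_add, one_mul, Nat.cast_zero, zero_add, mul_one]
    exact ⟨φ⟩
  | succ p ih =>
    set c := (p + 1) * (t + 1) with hc
    have hcp : c = p * (t + 1) + t + 1 := by rw [hc]; ring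
    have hcl : c * l + s = (p * (t + 1) + 1) * l + m := by rw [hc, hmt]; ring
    have front_eq := frontVertices_union_runFacet (x := x) (b := p * (t + 1) + 1) (c := c) hlm
      (by omega) (by omega)
    have hne := last_label_mem_sdiff_frontVertices hl hlm hx hW (b := c + 1) (by omega)
    obtain ⟨φ⟩ := ih (by omega)
    rw [← front_eq, ← Finset.sup_eq_union, ← sdiff_sdiff_left] at hne
    obtain ⟨ψ⟩ := nonempty_shorten_run_equiv K hs hmt hx h𝓞 (c := c)
      (W := W \ frontVertices l m x (p * (t + 1) + 2))
      (fun k hck hk => Finset.mem_sdiff.2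
        ⟨hW k hk, label_notMem_frontVertices hx hlm hk (hcl ▸ hck)⟩)
      (by omega) ⟨_, hne⟩ (i - 2 * (p + 1))
    rw [sdiff_sdiff_left, Finset.sup_eq_union, front_eq] at ψ
    have index_eq : (p + 1 + 1) * (t + 1) = c + t + 1 := by rw [hc]; ring
    have degree_eq : i - 2 * (p + 1) - 2 = i - 2 * ((p + 1 : ℕ) + 1) := by push_cast; ring
    rw [index_eq, ← degree_eq]
    exact ⟨φ.trans ψ⟩

theorem isAcyclic_complementComplex_run (K : Type*) [Field K] (hs : s < l) (hmt : m = t * l + s)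
    (hlm : l ≤ m) (hx : Set.InjOn x (Set.Iio ((q - 1) * l + m)))
    (h𝓞 : ∀ F ∈ 𝓞, ∀ k < (q - 1) * l + m, x k ∉ F) (hW : ∀ k < (q - 1) * l + m, x k ∈ W)
    (p : ℕ) (hpq : p * (t + 1) + 3 ≤ q) (hqp : q ≤ (p + 1) * (t + 1)) :
    IsAcyclic K (complementComplex W (𝓞 ∪ backFacets l m x 0 q)) := by
  intro i
  obtain ⟨φ⟩ := nonempty_shorten_run_iterate_equiv K hs hmt hlm hx h𝓞 hW p hpq i
  rw [backFacets_eq_empty hqp, Set.union_empty] at φ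
  have apex_mem := last_label_mem_sdiff_frontVertices (Nat.zero_lt_of_lt hs) hlm hx hW
    (b := p * (t + 1) + 1) (by omega)
  have := (isCone_complementComplex apex_mem fun F hF => h𝓞 F hF _ (by omega)).isAcyclic (K := K)
    (i - 2 * (p + 1))
  exact φ.injective.subsingleton

end Shortening

section Union

namespace IsDisjointUnionOfRuns

variable {V : Type*} [Fintype V] [DecidableEq V] {l m r : ℕ} {Γ : LowerSet (Finset V)}
  {R : Fin r → LowerSet (Finset V)} {len : Fin r → ℕ} {x : Fin r → ℕ → V}

theorem facets_eq (h : IsDisjointUnionOfRuns l m Γ R len x) : facets Γ = ⋃ j, facets (R j) := by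
  have sized : (⋃ j, facets (R j)).Sized m := Set.sized_iUnion.2 fun j => (h.isRun j).sized_facets
  rw [← facets_generated sized.isAntichain, generated, lowerClosure_iUnion, h.union]
  exact congrArg facets (iSup_congr fun j => (generated_facets (R j)).symm)

theorem facets_eq_union (h : IsDisjointUnionOfRuns l m Γ R len x) (j : Fin r) :
    facets Γ = otherFacets R j ∪ backFacets l m (x j) 0 (len j) := by
  rw [h.facets_eq, ← (h.isRun j).facets_eq]
  ext F
  simp only [Set.mem_iUnion, Set.mem_union, otherFacets, Set.mem_ofPred_eq]
  constructor
  · rintro ⟨j', hF⟩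
    by_cases hj : j' = j
    · exact Or.inr (hj ▸ hF)
    · exact Or.inl ⟨j', hj, hF⟩
  · rintro (⟨j', -, hF⟩ | hF)
    · exact ⟨j', hF⟩
    · exact ⟨j, hF⟩

theorem facetComplement_eq (h : IsDisjointUnionOfRuns l m Γ R len x) (j : Fin r) :
    facetComplement Γ =
      complementComplex (vertexSet Γ) (otherFacets R j ∪ backFacets l m (x j) 0 (len j)) := by
  rw [← h.facets_eq_union]
  rfl

theorem label_mem_vertexSet (h : IsDisjointUnionOfRuns l m Γ R len x) (hlm : l ≤ m) (j : Fin r) :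
    ∀ k < (len j - 1) * l + m, x j k ∈ vertexSet Γ := by
  intro k hk
  have hkR := (h.isRun j).label_mem_vertexSet hlm hk
  rw [mem_vertexSet] at hkR ⊢
  rw [h.union, LowerSet.mem_iSup_iff]
  exact ⟨j, hkR⟩

theorem label_notMem_otherFacets (h : IsDisjointUnionOfRuns l m Γ R len x) (hlm : l ≤ m)
    (j : Fin r) : ∀ F ∈ otherFacets R j, ∀ k < (len j - 1) * l + m, x j k ∉ F := by
  rintro F ⟨j', hj', hF⟩ k hk hkF
  exact Finset.disjoint_left.1 (h.disjoint j' j hj')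
    (mem_vertexSet_iff_exists_facet.2 ⟨F, hF, hkF⟩) ((h.isRun j).label_mem_vertexSet hlm hk)

theorem vertexSet_generated_otherFacets (h : IsDisjointUnionOfRuns l m Γ R len x) (j : Fin r) :
    vertexSet (generated (otherFacets R j)) =
      vertexSet Γ \ frontVertices l m (x j) (len j) := by
  ext v
  rw [← (h.isRun j).vertexSet_eq, Finset.mem_sdiff, mem_vertexSet_generated,
    mem_vertexSet_iff_exists_facet, h.facets_eq_union j, ← (h.isRun j).facets_eq]
  constructor
  · rintro ⟨F, hF, hv⟩
    obtain ⟨j', hj', hFj'⟩ := id hF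
    exact ⟨⟨F, Or.inl hF, hv⟩, Finset.disjoint_left.1 (h.disjoint j' j hj')
      (mem_vertexSet_iff_exists_facet.2 ⟨F, hFj', hv⟩)⟩
  · rintro ⟨⟨F, hF | hF, hv⟩, hvj⟩
    · exact ⟨F, hF, hv⟩
    · exact absurd (mem_vertexSet_iff_exists_facet.2 ⟨F, hF, hv⟩) hvj

theorem vertexSet_generated_otherFacets_nonempty (h : IsDisjointUnionOfRuns l m Γ R len x)
    (hm : 0 < m) (hr : 2 ≤ r) (j : Fin r) :
    (vertexSet (generated (otherFacets R j))).Nonempty := by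
  have : Nontrivial (Fin r) := Fin.nontrivial_iff_two_le.2 hr
  obtain ⟨j', hj'⟩ := exists_ne j
  refine ⟨x j' 0, mem_vertexSet_generated.2 ⟨runFacet l m (x j') 0, ⟨j', hj', ?_⟩, ?_⟩⟩
  · rw [(h.isRun j').facets_eq]
    exact ⟨0, le_rfl, (h.isRun j').pos, rfl⟩
  · exact mem_runFacet.2 ⟨0, by omega, by omega, rfl⟩

end IsDisjointUnionOfRuns

end Union

section Components

namespace IsDisjointUnionOfRuns

variable {V : Type*} [Fintype V] [LinearOrder V] {l m r s t p : ℕ} {Γ : LowerSet (Finset V)}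
  {R : Fin r → LowerSet (Finset V)} {len : Fin r → ℕ} {x : Fin r → ℕ → V} {j : Fin r}

theorem nonempty_shorten_component_equiv (h : IsDisjointUnionOfRuns l m Γ R len x) (K : Type*)
    [Field K] (hs : s < l) (hmt : m = t * l + s) (hlm : l ≤ m) (hp : p * (t + 1) + 3 ≤ len j)
    (i : ℤ) :
    Nonempty (ReducedHomology K (facetComplement Γ) i ≃ₗ[K]
      ReducedHomology K
        (complementComplex (vertexSet Γ \ frontVertices l m (x j) (p * (t + 1) + 2))
          (otherFacets R j ∪ backFacets l m (x j) ((p + 1) * (t + 1)) (len j)))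
        (i - 2 * (p + 1))) := by
  rw [h.facetComplement_eq j]
  exact nonempty_shorten_run_iterate_equiv K hs hmt hlm (h.isRun j).injOn
    (h.label_notMem_otherFacets hlm j) (h.label_mem_vertexSet hlm j) p hp i

theorem nonempty_remove_component_of_length_two_equiv (h : IsDisjointUnionOfRuns l m Γ R len x)
    (K : Type*) [Field K] (hs : s < l) (hmt : m = t * l + s) (hlm : l ≤ m) (ht : 0 < t)
    (hj : len j = 2) (hr : 2 ≤ r) (i : ℤ) :
    Nonempty (ReducedHomology K (facetComplement Γ) i ≃ₗ[K]
      ReducedHomology K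
        (complementComplex (vertexSet (generated (otherFacets R j))) (otherFacets R j))
        (i - 2)) := by
  have hne := h.vertexSet_generated_otherFacets_nonempty (by omega) hr j
  rw [h.vertexSet_generated_otherFacets, hj, frontVertices_two] at hne ⊢
  obtain ⟨φ⟩ := nonempty_shorten_run_equiv K hs hmt (h.isRun j).injOn
    (h.label_notMem_otherFacets hlm j) (fun k _ => h.label_mem_vertexSet hlm j k) hj.ge hne i
  rw [← h.facetComplement_eq, backFacets_eq_empty (by omega), Set.union_empty] at φ
  exact ⟨φ⟩

theorem nonempty_remove_component_of_length_one_equiv (h : IsDisjointUnionOfRuns l m Γ R len x)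
    (K : Type*) [Field K] (hm : 0 < m) (hlm : l ≤ m) (hj : len j = 1) (hr : 2 ≤ r) (i : ℤ) :
    Nonempty (ReducedHomology K (facetComplement Γ) i ≃ₗ[K]
      ReducedHomology K
        (complementComplex (vertexSet (generated (otherFacets R j))) (otherFacets R j))
        (i - 1)) := by
  have hne := h.vertexSet_generated_otherFacets_nonempty hm hr j
  rw [h.vertexSet_generated_otherFacets, hj, frontVertices_one] at hne ⊢
  rw [h.facetComplement_eq j, hj, backFacets_eq_insert one_pos, backFacets_eq_empty (zero_add 1).ge,
    Set.union_insert, Set.union_empty]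
  exact nonempty_complementComplex_insert_equiv K (h.label_mem_vertexSet hlm j 0 (by omega))
    (fun F hF => h.label_notMem_otherFacets hlm j F hF 0 (by omega)) hne i

theorem isAcyclic_facetComplement (h : IsDisjointUnionOfRuns l m Γ R len x) (K : Type*)
    [Field K] (hs : s < l) (hmt : m = t * l + s) (hlm : l ≤ m) (hp : p * (t + 1) + 3 ≤ len j)
    (hjp : len j ≤ (p + 1) * (t + 1)) : IsAcyclic K (facetComplement Γ) := by
  rw [h.facetComplement_eq j]
  exact isAcyclic_complementComplex_run K hs hmt hlm (h.isRun j).injOn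
    (h.label_notMem_otherFacets hlm j) (h.label_mem_vertexSet hlm j) p hp hjp

end IsDisjointUnionOfRuns

end Components

end PathRuns

open PathRuns in
theorem proposition4p3_general (K : Type*) [Field K] {V : Type*} [Fintype V] [LinearOrder V]
    {l m s t r p d : ℕ} (hs : s < l) (hmt : m = t * l + s) (ht : 2 ≤ t)
    {Γ : LowerSet (Finset V)} {R : Fin r → LowerSet (Finset V)} {len : Fin r → ℕ}
    {x : Fin r → ℕ → V} (hruns : IsDisjointUnionOfRuns l m Γ R len x) {j : Fin r}
    (hlen : len j = p * (t + 1) + d) (hd : d ≤ t) (i : ℤ) :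
    (t + 2 ≤ len j →
      Nonempty (ReducedHomology K (facetComplement Γ) i ≃ₗ[K]
        ReducedHomology K
          (complementComplex (vertexSet Γ \ frontVertices l m (x j) ((p - 1) * (t + 1) + 2))
            (otherFacets R j ∪ backFacets l m (x j) (p * (t + 1)) (p * (t + 1) + d)))
          (i - 2 * (p : ℤ)))) ∧
    (len j = 2 → 2 ≤ r →
      Nonempty (ReducedHomology K (facetComplement Γ) i ≃ₗ[K]
        ReducedHomology K
          (complementComplex (vertexSet (generated (otherFacets R j))) (otherFacets R j))
          (i - 2))) ∧
    (len j = 1 → 2 ≤ r →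
      Nonempty (ReducedHomology K (facetComplement Γ) i ≃ₗ[K]
        ReducedHomology K
          (complementComplex (vertexSet (generated (otherFacets R j))) (otherFacets R j))
          (i - 1))) ∧
    (d ≠ 1 ∧ d ≠ 2 → Subsingleton (ReducedHomology K (facetComplement Γ) i)) := by
  have h2l : 2 * l ≤ t * l := Nat.mul_le_mul_right l ht
  have hlm : l ≤ m := by omega
  refine ⟨fun hj => ?_, fun hj hr => ?_, fun hj hr => ?_, fun hd12 => ?_⟩
  · obtain ⟨p, rfl⟩ : ∃ p', p = p' + 1 :=
      Nat.exists_eq_succ_of_ne_zero (by rintro rfl; omega)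
    have hp : (p + 1) * (t + 1) = p * (t + 1) + (t + 1) := Nat.succ_mul p (t + 1)
    rw [← hlen, Nat.add_sub_cancel, Nat.cast_add_one]
    exact hruns.nonempty_shorten_component_equiv K hs hmt hlm (by omega) i
  · exact hruns.nonempty_remove_component_of_length_two_equiv K hs hmt hlm (by omega) hj hr i
  · exact hruns.nonempty_remove_component_of_length_one_equiv K (by omega) hlm hj hr i
  · obtain ⟨p', hp', hjp'⟩ : ∃ p', p' * (t + 1) + 3 ≤ len j ∧ len j ≤ (p' + 1) * (t + 1) := by
      have hpos := (hruns.isRun j).pos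
      by_cases hd0 : d = 0
      · obtain ⟨p, rfl⟩ : ∃ p', p = p' + 1 :=
          Nat.exists_eq_succ_of_ne_zero (by rintro rfl; omega)
        exact ⟨p, by rw [hlen, Nat.succ_mul]; omega, by rw [hlen, hd0, add_zero]⟩
      · exact ⟨p, by omega, by rw [hlen, Nat.succ_mul]; omega⟩
    exact hruns.isAcyclic_facetComplement K hs hmt hlm hp' hjp' i

theorem proposition4p3 (K : Type*) [Field K] (l m n s t : ℕ)
    (hl : 0 < l) (hm : 2 ≤ m) (hmn : m ≤ n) (hln : l ∣ n) (hlm : l ≤ m - 1) (hl2 : 2 * l ≤ n)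
    (hs : s < l) (hmt : m = t * l + s) (ht : 2 ≤ t)
    (Γ : LowerSet (Finset (Fin n)))
    (hΓ : PathRuns.IsSubcollection Γ (PathRuns.cyclePathComplex n l m))
    (r : ℕ) (R : Fin r → LowerSet (Finset (Fin n))) (len p d : Fin r → ℕ)
    (x : Fin r → ℕ → Fin n)
    (hruns : PathRuns.IsDisjointUnionOfRuns l m Γ R len x)
    (hlen : ∀ j, len j = p j * (t + 1) + d j) (hd : ∀ j, d j ≤ t)
    (j : Fin r) (i : ℤ) :
    -- (1) a run of length at least t + 2 can be shortened to its last `d j` facets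
    (t + 2 ≤ len j →
      Nonempty (PathRuns.ReducedHomology K (PathRuns.facetComplement Γ) i ≃ₗ[K]
        PathRuns.ReducedHomology K
          (PathRuns.complementComplex
            (PathRuns.vertexSet Γ \
              PathRuns.frontVertices l m (x j) ((p j - 1) * (t + 1) + 2))
            (PathRuns.otherFacets R j ∪
              {F | ∃ a, p j * (t + 1) ≤ a ∧ a < p j * (t + 1) + d j ∧
                F = PathRuns.runFacet l m (x j) a}))
          (i - 2 * (p j : ℤ)))) ∧
    -- (2) a run of length 2 can be removed
    (len j = 2 → 2 ≤ r →
      Nonempty (PathRuns.ReducedHomology K (PathRuns.facetComplement Γ) i ≃ₗ[K]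
        PathRuns.ReducedHomology K
          (PathRuns.complementComplex
            (PathRuns.vertexSet (PathRuns.generated (PathRuns.otherFacets R j)))
            (PathRuns.otherFacets R j))
          (i - 2))) ∧
    -- (3) a run of length 1 can be removed
    (len j = 1 → 2 ≤ r →
      Nonempty (PathRuns.ReducedHomology K (PathRuns.facetComplement Γ) i ≃ₗ[K]
        PathRuns.ReducedHomology K
          (PathRuns.complementComplex
            (PathRuns.vertexSet (PathRuns.generated (PathRuns.otherFacets R j)))
            (PathRuns.otherFacets R j))
          (i - 1))) ∧
    -- (4) vanishing
    (d j ≠ 1 ∧ d j ≠ 2 →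
      Subsingleton (PathRuns.ReducedHomology K (PathRuns.facetComplement Γ) i)) :=
  proposition4p3_general K hs hmt ht hruns (hlen j) (hd j) i
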